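/- Let $X$ be a reflexive Banach space, $(\Omega,\beta,\mu)$ a finite measure space, and $\tau:\Omega\to\Omega$ an endomorphism of it (a measurable map preserving $\mu$). Put $Tg=g\circ\tau$ and $S_n g=\frac1n\sum_{i=0}^{n-1}T^i g$. Let $(F_n)$ be a sequence of $\sigma$-subalgebras of $\beta$ that either increases, with $F_\infty=\sigma\big(\bigcup_n F_n\big)$, or decreases, with $F_\infty=\bigcap_n F_n$. Let $E(\cdot\,|\,F)$ denote conditional expectation with respect to $F$. Let $1\le p<\infty$ and $f\in L_p(\Omega,X)$, and put $f_\infty=E(f|F_\infty)$. Then the limits $$f^*=\lim_{n\to\infty}S_nf,\qquad f_\infty^*=\lim_{n\to\infty}S_nf_\infty$$ exist a.e. and in $L_p(\Omega,X)$, and the following hold. 1. $S_{n_1}\big(E(f|F_{n_2})\big)\to f_\infty^*$ in $L_p(\Omega,X)$ as $n_1,n_2\to\infty$ independently. Moreover $\|f_\infty^*\|_p\le\|f\|_p$ and $\|E(f^*|F_\infty)\|_p\le\|f\|_p$. 2. If $\sup_{n}\|E(f|F_{n})\|_X\in L_1$, then $S_{n_1}\big(E(f|F_{n_2})\big)\to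 f_\infty^*$ a.e. and in $L_1(\Omega,X)$ as $n_1,n_2\to\infty$ independently. Moreover $\int_\Omega f_\infty^*\,d\mu=\int_\Omega E(f^*|F_\infty)\,d\mu=\int_\Omega f\,d\mu$. -/

import Mathlib

open MeasureTheory Filter Topology

/-- A real normed space is reflexive when the canonical map into its bidual is onto. -/
def IsReflexiveSpace (X : Type*) [NormedAddCommGroup X] [NormedSpace ℝ X] : Prop :=
  Function.Surjective (NormedSpace.inclusionInDoubleDual ℝ X)

/-- The ergodic average `S_n g = (1/n) ∑_{i<n} T^i g` of the operator `T g = g ∘ τ`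
generated by `τ`, evaluated at `ω`. -/
noncomputable def ergAvg {Ω X : Type*} [NormedAddCommGroup X] [NormedSpace ℝ X]
    (τ : Ω → Ω) (n : ℕ) (g : Ω → X) (ω : Ω) : X :=
  (n : ℝ)⁻¹ • ∑ i ∈ Finset.range n, ((fun h : Ω → X => h ∘ τ)^[i] g) ω

/-- The limit `g^* = lim_n S_n g`, taken pointwise. At points where the averages do not converge
the value is arbitrary; `HasErgLimit` says that this happens only on a null set. -/
noncomputable def ergLimit {Ω X : Type*} [NormedAddCommGroup X] [NormedSpace ℝ X]
    (τ : Ω → Ω) (g : Ω → X) (ω : Ω) : X :=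
  limUnder atTop (fun n : ℕ => ergAvg τ n g ω)

/-- `g^*` is a genuine element of `L_p(Ω, X)`, and `S_n g → g^*` both a.e. and in `L_p`. -/
def HasErgLimit {Ω X : Type*} {mΩ : MeasurableSpace Ω} [NormedAddCommGroup X] [NormedSpace ℝ X]
    (μ : Measure Ω) (p : ENNReal) (τ : Ω → Ω) (g : Ω → X) : Prop :=
  MemLp (ergLimit τ g) p μ ∧
  (∀ᵐ ω ∂μ, Tendsto (fun n : ℕ => ergAvg τ n g ω) atTop (𝓝 (ergLimit τ g ω))) ∧
  Tendsto (fun n : ℕ => eLpNorm (fun ω => ergAvg τ n g ω - ergLimit τ g ω) p μ) atTop (𝓝 0)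

/-- `F_n ↑ F_∞` or `F_n ↓ F_∞`. -/
def MonotoneSigmaLimit {Ω : Type*} (F : ℕ → MeasurableSpace Ω) (Finf : MeasurableSpace Ω) : Prop :=
  (Monotone F ∧ Finf = ⨆ n, F n) ∨ (Antitone F ∧ Finf = ⨅ n, F n)

/-! Both limit operations are linear contractions of $L_p(\Omega,X)$ with a weak type $(1,1)$
maximal inequality: Hopf's theorem gives it for the averages $S_n$, Doob's inequality for the
conditional expectations. A maximal inequality carries a.e. convergence from a dense class to all of
$L_1$; approximation by bounded functions gives uniform integrability, and so turns a.e. convergence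
into $L_p$ convergence. Simple functions are dense, so vector values reduce to real ones. The real
inputs are Birkhoff's theorem for bounded functions, by an upcrossing argument, and convergence of
orthogonal projections in $L_2$ for decreasing $\sigma$-algebras.

The two-index limits rest on the splitting
$S_{n_1}E(f|F_{n_2})-f_\infty^*=S_{n_1}\big(E(f|F_{n_2})-f_\infty\big)+\big(S_{n_1}f_\infty-f_\infty^*\big)$.
The first term must be small uniformly in $n_1$. In $L_p$ this is the contraction property. Almost
everywhere it is the maximal inequality applied to the tail suprema of $\|E(f|F_n)-f_\infty\|$,
whose integrals tend to zero when the supremum is integrable (`ae_tendsto_birkhoffAverage_prod`). -/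

namespace MeasureTheory

/-! ### Approximation criteria and Hopf's maximal theorem -/

section

variable {Ω X : Type*} {mΩ : MeasurableSpace Ω} {μ : Measure Ω}
  [NormedAddCommGroup X] {τ : Ω → Ω}

/-- If the properties `P ε`, monotone in `ε`, fail with probability at most `ε`, then almost surely
all of them hold. -/
theorem ae_forall_pos_of_measure_le {P : ℝ → Ω → Prop}
    (hmono : ∀ ε ε' ω, ε ≤ ε' → P ε ω → P ε' ω)
    (h : ∀ ε, 0 < ε → μ {ω | ¬ P ε ω} ≤ ENNReal.ofReal ε) :
    ∀ᵐ ω ∂μ, ∀ ε, 0 < ε → P ε ω := by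
  have h0 : ∀ ε, 0 < ε → ∀ᵐ ω ∂μ, P ε ω := by
    intro ε hε
    have hlim : Tendsto (fun δ : ℝ => ENNReal.ofReal δ) (𝓝[>] 0) (𝓝 0) := by
      have := (ENNReal.continuous_ofReal.tendsto 0).mono_left
        (nhdsWithin_le_nhds (s := Set.Ioi (0 : ℝ)))
      simpa using this
    -- For $\delta\le\varepsilon$, failure of `P ε` forces failure of `P δ`, an event of measure at
    -- most $\delta$; let $\delta\to0$.
    refine le_antisymm (ge_of_tendsto hlim ?_) zero_le
    filter_upwards [Ioc_mem_nhdsGT hε] with δ hδ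
    exact (measure_mono fun ω (hω : ¬ P ε ω) => fun hP => hω (hmono _ _ _ hδ.2 hP)).trans (h δ hδ.1)
  have h1 : ∀ᵐ ω ∂μ, ∀ n : ℕ, P (1 / ((n : ℝ) + 1)) ω :=
    ae_all_iff.2 fun n => h0 _ Nat.one_div_pos_of_nat
  filter_upwards [h1] with ω hω ε hε
  obtain ⟨n, hn⟩ := exists_nat_one_div_lt hε
  exact hmono _ _ _ hn.le (hω n)

/-- A sequence of functions which is uniformly close, outside of small sets, to almost everywhere
Cauchy sequences is almost everywhere Cauchy. -/
theorem ae_cauchySeq_of_approx {u : ℕ → Ω → X}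
    (h : ∀ ε, 0 < ε → ∃ v : ℕ → Ω → X, (∀ᵐ ω ∂μ, CauchySeq fun n => v n ω) ∧
      μ {ω | ∃ n, ε < ‖u n ω - v n ω‖} ≤ ENNReal.ofReal ε) :
    ∀ᵐ ω ∂μ, CauchySeq fun n => u n ω := by
  have key : ∀ᵐ ω ∂μ, ∀ ε, 0 < ε → ∃ N, ∀ n ≥ N, dist (u n ω) (u N ω) < 3 * ε := by
    refine ae_forall_pos_of_measure_le
      (fun ε ε' ω hle ⟨N, hN⟩ => ⟨N, fun n hn => (hN n hn).trans_le (by linarith)⟩)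
      fun ε hε => ?_
    obtain ⟨v, hv, hμ⟩ := h ε hε
    refine le_trans (measure_mono_ae ?_) hμ
    filter_upwards [hv] with ω hω hnot
    by_contra hle
    replace hle : ∀ n, ‖u n ω - v n ω‖ ≤ ε := fun n => not_lt.1 fun hn => hle ⟨n, hn⟩
    refine hnot ?_
    obtain ⟨N, hN⟩ := Metric.cauchySeq_iff'.1 hω ε hε
    refine ⟨N, fun n hn => ?_⟩
    have h1 := hle n
    have h2 := hle N
    have h3 := hN n hn
    rw [← dist_eq_norm] at h1 h2
    calc dist (u n ω) (u N ω)
        ≤ dist (u n ω) (v n ω) + dist (v n ω) (v N ω) + dist (v N ω) (u N ω) :=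
          dist_triangle4 _ _ _ _
      _ < 3 * ε := by rw [dist_comm (v N ω)]; linarith
  filter_upwards [key] with ω hω
  refine Metric.cauchySeq_iff'.2 fun ε hε => ?_
  obtain ⟨N, hN⟩ := hω (ε / 3) (by positivity)
  exact ⟨N, fun n hn => (hN n hn).trans_eq (by ring)⟩

/-- A sequence which is uniformly close in `L^p` to uniformly bounded sequences is uniformly
integrable. -/
theorem unifIntegrable_of_approx_bounded {p : ENNReal} (hp : 1 ≤ p) (hp' : p ≠ ⊤)
    {u : ℕ → Ω → X} (hu : ∀ n, AEStronglyMeasurable (u n) μ)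
    (h : ∀ ε : ENNReal, 0 < ε → ∃ (v : ℕ → Ω → X) (C : ℝ), (∀ n, AEStronglyMeasurable (v n) μ) ∧
      (∀ n, ∀ᵐ ω ∂μ, ‖v n ω‖ ≤ C) ∧ ∀ n, eLpNorm (u n - v n) p μ ≤ ε) :
    UnifIntegrable u p μ := by
  intro ε hε
  obtain ⟨v, C, hvm, hvC, huv⟩ := h (ENNReal.ofReal (ε / 2)) (by simpa using hε)
  have hp0 : 0 < p.toReal := ENNReal.toReal_pos (by positivity) hp'
  -- On a set of measure at most $\delta$, a function bounded by $C$ has $L_p$ norm at most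
  -- $\delta^{1/p}C$; this determines the choice of $\delta$.
  have hlim : Tendsto (fun δ : ENNReal => δ ^ p.toReal⁻¹ * ENNReal.ofReal C) (𝓝 0) (𝓝 0) := by
    have h1 : Tendsto (fun δ : ENNReal => δ ^ p.toReal⁻¹) (𝓝 0) (𝓝 0) := by
      have := (ENNReal.continuous_rpow_const (y := p.toReal⁻¹)).tendsto 0
      rwa [ENNReal.zero_rpow_of_pos (by positivity)] at this
    simpa using ENNReal.Tendsto.mul_const h1 (Or.inr (ENNReal.ofReal_ne_top (r := C)))
  have hev : ∀ᶠ δ : ENNReal in 𝓝 0, δ ^ p.toReal⁻¹ * ENNReal.ofReal C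
      ≤ ENNReal.ofReal (ε / 2) :=
    (hlim.eventually_lt_const (u := ENNReal.ofReal (ε / 2)) (by simpa using hε)).mono
      fun _ h => h.le
  obtain ⟨δ, hδ, hδle⟩ : ∃ δ : ℝ, 0 < δ ∧
      ENNReal.ofReal δ ^ p.toReal⁻¹ * ENNReal.ofReal C ≤ ENNReal.ofReal (ε / 2) := by
    have h2 : Tendsto (fun δ : ℝ => ENNReal.ofReal δ) (𝓝[>] 0) (𝓝 0) := by
      have := (ENNReal.continuous_ofReal.tendsto 0).mono_left
        (nhdsWithin_le_nhds (s := Set.Ioi (0 : ℝ)))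
      simpa using this
    obtain ⟨δ, h3, h4⟩ := ((h2.eventually hev).and self_mem_nhdsWithin).exists
    exact ⟨δ, h4, h3⟩
  refine ⟨δ, hδ, fun n s hs hμs => ?_⟩
  have hsplit : s.indicator (u n) = s.indicator (u n - v n) + s.indicator (v n) := by
    rw [← Set.indicator_add']; simp
  rw [hsplit]
  refine (eLpNorm_add_le (((hu n).sub (hvm n)).indicator hs) ((hvm n).indicator hs) hp).trans ?_
  have h1 : eLpNorm (s.indicator (u n - v n)) p μ ≤ ENNReal.ofReal (ε / 2) :=
    (eLpNorm_indicator_le _).trans (huv n)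
  have h2 : eLpNorm (s.indicator (v n)) p μ ≤ ENNReal.ofReal (ε / 2) := by
    rw [eLpNorm_indicator_eq_eLpNorm_restrict hs]
    refine (eLpNorm_le_of_ae_bound (ae_restrict_of_ae (hvC n))).trans (le_trans ?_ hδle)
    rw [Measure.restrict_apply_univ]
    gcongr
  calc _ ≤ ENNReal.ofReal (ε / 2) + ENNReal.ofReal (ε / 2) := add_le_add h1 h2
    _ = ENNReal.ofReal ε := by
      rw [← ENNReal.ofReal_add (by positivity) (by positivity), add_halves]

/-- Hopf's maximal ergodic theorem. -/
theorem MeasurePreserving.setIntegral_exists_birkhoffSum_pos_nonneg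
    (hτ : MeasurePreserving τ μ μ) {g : Ω → ℝ} (hg : Integrable g μ) (hgm : Measurable g) :
    0 ≤ ∫ ω in {ω | ∃ n, 0 < birkhoffSum τ g n ω}, g ω ∂μ := by
  -- The maximum runs over $0\le n\le N$; the empty sum at $n=0$ makes it nonnegative.
  set M : ℕ → Ω → ℝ := fun N => partialSups (birkhoffSum τ g) N with hM
  have hBm : ∀ n, Measurable (birkhoffSum τ g n) := fun n =>
    Finset.measurable_sum _ fun i _ => hgm.comp (hτ.measurable.iterate i)
  have hBi : ∀ n, Integrable (birkhoffSum τ g n) μ := fun n =>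
    integrable_finsetSum _ fun i _ => (hτ.iterate i).integrable_comp_of_integrable hg
  have hMm : ∀ N, Measurable (M N) := by
    intro N
    induction N with
    | zero => exact (show M 0 = 0 by simp [hM]) ▸ measurable_zero
    | succ N ih =>
      have : M (N + 1) = M N ⊔ birkhoffSum τ g (N + 1) := partialSups_add_one _ _
      rw [this]; exact ih.sup (hBm _)
  have hMi : ∀ N, Integrable (M N) μ := by
    intro N
    induction N with
    | zero => simp [hM]
    | succ N ih =>
      have : M (N + 1) = M N ⊔ birkhoffSum τ g (N + 1) := partialSups_add_one _ _
      rw [this]; exact ih.sup (hBi _)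
  have hle : ∀ {k N}, k ≤ N → ∀ ω, birkhoffSum τ g k ω ≤ M N ω := fun h ω =>
    le_partialSups_of_le (birkhoffSum τ g) h ω
  have hM0 : ∀ N ω, 0 ≤ M N ω := fun N ω => by simpa using hle (Nat.zero_le N) ω
  have hMle : ∀ N ω, M N ω ≤ max 0 (g ω + M N (τ ω)) := by
    intro N
    have : partialSups (birkhoffSum τ g) N ≤ fun ω => max 0 (g ω + M N (τ ω)) := by
      refine partialSups_le _ _ _ fun k hk ω => ?_
      cases k with
      | zero => simp
      | succ k =>
        rw [birkhoffSum_succ']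
        exact le_max_of_le_right (add_le_add le_rfl (hle (by omega) _))
    exact this
  have hN : ∀ N, 0 ≤ ∫ ω in {ω | 0 < M N ω}, g ω ∂μ := by
    intro N
    have hEm : MeasurableSet {ω | 0 < M N ω} := measurableSet_lt measurable_const (hMm N)
    have hMτ : Integrable (fun ω => M N (τ ω)) μ := hτ.integrable_comp_of_integrable (hMi N)
    rw [← integral_indicator hEm]
    have h0 : ∫ ω, (M N ω - M N (τ ω)) ∂μ = 0 := by
      rw [integral_sub (hMi N) hMτ, sub_eq_zero]
      conv_lhs => rw [← hτ.map_eq]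
      exact integral_map hτ.measurable.aemeasurable (hMm N).aestronglyMeasurable
    -- Pointwise $M_N-M_N\circ\tau\le g\,1_{\{M_N>0\}}$, and the left side has integral zero by
    -- invariance of $\mu$.
    refine h0.ge.trans (integral_mono ((hMi N).sub hMτ) (hg.indicator hEm) fun ω => ?_)
    by_cases hω : 0 < M N ω
    · have := hMle N ω
      rw [Set.indicator_of_mem (by exact hω)]
      rcases le_max_iff.1 this with h | h
      · exact absurd hω (not_lt.2 h)
      · simp only; linarith
    · rw [Set.indicator_of_notMem (by exact hω)]
      have := hM0 N (τ ω)
      simp only; linarith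
  have hunion : {ω | ∃ n, 0 < birkhoffSum τ g n ω} = ⋃ N, {ω | 0 < M N ω} := by
    ext ω
    simp only [Set.mem_ofPred_eq, Set.mem_iUnion]
    constructor
    · rintro ⟨n, hn⟩
      exact ⟨n, hn.trans_le (hle le_rfl ω)⟩
    · rintro ⟨N, hN⟩
      by_contra! hcon
      have : partialSups (birkhoffSum τ g) N ω ≤ 0 := by
        rw [Pi.partialSups_apply]
        exact partialSups_le _ _ _ fun k _ => hcon k
      exact absurd hN (not_lt.2 this)
  rw [hunion]
  refine ge_of_tendsto' (tendsto_setIntegral_of_monotone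
    (fun N => measurableSet_lt measurable_const (hMm N)) (fun m n hmn ω hω => ?_)
    hg.integrableOn) hN
  exact lt_of_lt_of_le (show 0 < M m ω from hω) ((partialSups (birkhoffSum τ g)).monotone hmn ω)

end

/-! ### Birkhoff averages: contraction and maximal inequalities -/

section

variable {Ω X : Type*} {mΩ : MeasurableSpace Ω} {μ : Measure Ω}
  [NormedAddCommGroup X] [NormedSpace ℝ X] {τ : Ω → Ω}

theorem norm_birkhoffAverage_le (g : Ω → X) (n : ℕ) (ω : Ω) :
    ‖birkhoffAverage ℝ τ g n ω‖ ≤ birkhoffAverage ℝ τ (fun ω => ‖g ω‖) n ω := by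
  rw [birkhoffAverage, birkhoffAverage, norm_smul, norm_inv, Real.norm_natCast, smul_eq_mul]
  exact mul_le_mul_of_nonneg_left (norm_sum_le _ _) (by positivity)

theorem birkhoffAverage_mono {g h : Ω → ℝ} {ω : Ω} (hgh : ∀ i, g (τ^[i] ω) ≤ h (τ^[i] ω))
    (n : ℕ) : birkhoffAverage ℝ τ g n ω ≤ birkhoffAverage ℝ τ h n ω :=
  mul_le_mul_of_nonneg_left (Finset.sum_le_sum fun i _ => hgh i) (by positivity)

theorem birkhoffAverage_le_of_forall_le {g : Ω → ℝ} {C : ℝ} (hC : 0 ≤ C) {ω : Ω}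
    (hg : ∀ i, g (τ^[i] ω) ≤ C) (n : ℕ) : birkhoffAverage ℝ τ g n ω ≤ C := by
  rcases Nat.eq_zero_or_pos n with rfl | hn
  · simpa [birkhoffAverage_zero] using hC
  rw [birkhoffAverage, smul_eq_mul, inv_mul_le_iff₀ (by positivity), birkhoffSum]
  simpa using Finset.sum_le_card_nsmul (Finset.range n) _ C fun i _ => hg i

theorem norm_birkhoffAverage_le_of_forall_le {g : Ω → X} {C : ℝ} (hC : 0 ≤ C) {ω : Ω}
    (hg : ∀ i, ‖g (τ^[i] ω)‖ ≤ C) (n : ℕ) : ‖birkhoffAverage ℝ τ g n ω‖ ≤ C :=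
  (norm_birkhoffAverage_le g n ω).trans (birkhoffAverage_le_of_forall_le hC hg n)

theorem birkhoffSum_sub_const (g : Ω → ℝ) (a : ℝ) (n : ℕ) (ω : Ω) :
    birkhoffSum τ (fun ω => g ω - a) n ω = birkhoffSum τ g n ω - n * a := by
  simp [birkhoffSum, Finset.sum_sub_distrib]

theorem lt_birkhoffAverage_iff (g : Ω → ℝ) {a : ℝ} {n : ℕ} (hn : 0 < n) (ω : Ω) :
    a < birkhoffAverage ℝ τ g n ω ↔ 0 < birkhoffSum τ (fun ω => g ω - a) n ω := by
  rw [birkhoffSum_sub_const, birkhoffAverage, smul_eq_mul, lt_inv_mul_iff₀ (by positivity), sub_pos]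

theorem MeasurePreserving.aestronglyMeasurable_birkhoffAverage (hτ : MeasurePreserving τ μ μ)
    {g : Ω → X} (hg : AEStronglyMeasurable g μ) (n : ℕ) :
    AEStronglyMeasurable (birkhoffAverage ℝ τ g n) μ := by
  have : birkhoffAverage ℝ τ g n = (n : ℝ)⁻¹ • fun ω => ∑ i ∈ Finset.range n, g (τ^[i] ω) := rfl
  rw [this]
  exact (Finset.aestronglyMeasurable_fun_sum _ fun i _ =>
    hg.comp_measurePreserving (hτ.iterate i)).const_smul _

theorem MeasurePreserving.eLpNorm_birkhoffAverage_le (hτ : MeasurePreserving τ μ μ)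
    {g : Ω → X} (hg : AEStronglyMeasurable g μ) {p : ENNReal} (hp : 1 ≤ p) (n : ℕ) :
    eLpNorm (birkhoffAverage ℝ τ g n) p μ ≤ eLpNorm g p μ := by
  rcases Nat.eq_zero_or_pos n with rfl | hn
  · simp
  have h1 : birkhoffAverage ℝ τ g n = (n : ℝ)⁻¹ • ∑ i ∈ Finset.range n, g ∘ τ^[i] := by
    ext ω; simp [birkhoffAverage, birkhoffSum]
  have h2 : ∀ i, eLpNorm (g ∘ τ^[i]) p μ = eLpNorm g p μ := fun i =>
    eLpNorm_comp_measurePreserving hg (hτ.iterate i)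
  rw [h1, eLpNorm_const_smul]
  calc ‖(n : ℝ)⁻¹‖ₑ * eLpNorm (∑ i ∈ Finset.range n, g ∘ τ^[i]) p μ
      ≤ ‖(n : ℝ)⁻¹‖ₑ * ∑ i ∈ Finset.range n, eLpNorm (g ∘ τ^[i]) p μ := by
        gcongr
        exact eLpNorm_sum_le (fun i _ => hg.comp_measurePreserving (hτ.iterate i)) hp
    _ = eLpNorm g p μ := by
        simp only [h2, Finset.sum_const, Finset.card_range, nsmul_eq_mul]
        rw [← mul_assoc, enorm_inv (by positivity), Real.enorm_natCast,
          ENNReal.inv_mul_cancel (by simpa using hn.ne') (by simp), one_mul]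

/-- The weak type `(1, 1)` maximal inequality for Birkhoff averages. -/
theorem MeasurePreserving.mul_measure_exists_lt_norm_birkhoffAverage_le [IsFiniteMeasure μ]
    (hτ : MeasurePreserving τ μ μ) {g : Ω → X} (hg : Integrable g μ) {a : ℝ} (ha : 0 < a) :
    ENNReal.ofReal a * μ {ω | ∃ n, a < ‖birkhoffAverage ℝ τ g n ω‖} ≤ eLpNorm g 1 μ := by
  set g' := hg.1.mk g
  have hg' : StronglyMeasurable g' := hg.1.stronglyMeasurable_mk
  have hgg' : g =ᵐ[μ] g' := hg.1.ae_eq_mk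
  have hgi' : Integrable g' μ := hg.congr hgg'
  have hgm' : Measurable fun ω => ‖g' ω‖ := hg'.norm.measurable
  set E := {ω | ∃ n, 0 < birkhoffSum τ (fun ω => ‖g' ω‖ - a) n ω} with hE
  have hEm : MeasurableSet E := by
    have : E = ⋃ n, {ω | 0 < birkhoffSum τ (fun ω => ‖g' ω‖ - a) n ω} := by
      ext ω; simp [hE]
    rw [this]
    exact MeasurableSet.iUnion fun n => measurableSet_lt measurable_const <|
      Finset.measurable_sum _ fun i _ => (hgm'.sub_const a).comp (hτ.measurable.iterate i)
  have hle : μ {ω | ∃ n, a < ‖birkhoffAverage ℝ τ g n ω‖} ≤ μ E := by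
    refine measure_mono_ae ?_
    filter_upwards [ae_all_iff.2 fun n =>
      Measure.QuasiMeasurePreserving.birkhoffAverage_ae_eq_of_ae_eq ℝ hτ.quasiMeasurePreserving
        hgg' n] with ω hω hex
    obtain ⟨n, hn⟩ : ∃ n, a < ‖birkhoffAverage ℝ τ g n ω‖ := hex
    rcases Nat.eq_zero_or_pos n with rfl | hn0
    · simp [birkhoffAverage_zero] at hn; linarith
    refine ⟨n, (lt_birkhoffAverage_iff _ hn0 ω).1 (hn.trans_le ?_)⟩
    rw [hω n]
    exact norm_birkhoffAverage_le _ _ _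
  have hmax : 0 ≤ ∫ ω in E, (‖g' ω‖ - a) ∂μ :=
    hτ.setIntegral_exists_birkhoffSum_pos_nonneg (hgi'.norm.sub (integrable_const a))
      (hgm'.sub_const a)
  rw [integral_sub hgi'.norm.integrableOn (integrable_const a), setIntegral_const, smul_eq_mul,
    sub_nonneg] at hmax
  have h1 : a * μ.real E ≤ ∫ ω, ‖g' ω‖ ∂μ := by
    rw [mul_comm]
    exact hmax.trans (setIntegral_le_integral hgi'.norm (ae_of_all _ fun ω => norm_nonneg _))
  calc _ ≤ ENNReal.ofReal a * μ E := by gcongr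
    _ = ENNReal.ofReal (a * μ.real E) := by
      rw [ENNReal.ofReal_mul ha.le, ofReal_measureReal]
    _ ≤ ENNReal.ofReal (∫ ω, ‖g' ω‖ ∂μ) := ENNReal.ofReal_le_ofReal h1
    _ = eLpNorm g 1 μ := by
      rw [ofReal_integral_norm_eq_lintegral_enorm hgi', eLpNorm_congr_ae hgg',
        eLpNorm_one_eq_lintegral_enorm]

/-- If on an invariant set the Birkhoff averages of `g` exceed `b` infinitely often, then the mean
of `g` over this set is at least `b`. -/
theorem MeasurePreserving.const_mul_measureReal_le_setIntegral [IsFiniteMeasure μ]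
    (hτ : MeasurePreserving τ μ μ) {g : Ω → ℝ} (hg : Integrable g μ) (hgm : Measurable g)
    {E : Set Ω} (hE : MeasurableSet E) (hinv : τ ⁻¹' E = E) {b : ℝ}
    (hb : ∀ ω ∈ E, ∃ᶠ n in atTop, b < birkhoffAverage ℝ τ g n ω) :
    b * μ.real E ≤ ∫ ω in E, g ω ∂μ := by
  -- Invariance of $E$ lets Hopf's theorem be applied to $\mu|_E$, where the event that some sum of
  -- $g-b$ is positive has full measure.
  have hτE : MeasurePreserving τ (μ.restrict E) (μ.restrict E) := by
    have := hτ.restrict_preimage hE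
    rwa [hinv] at this
  have h := hτE.setIntegral_exists_birkhoffSum_pos_nonneg
    (g := fun ω => g ω - b) (hg.integrableOn.sub (integrable_const b)) (hgm.sub_const b)
  have hsub : E ⊆ {ω | ∃ n, 0 < birkhoffSum τ (fun ω => g ω - b) n ω} := fun ω hω => by
    obtain ⟨n, hn, hn0⟩ := ((hb ω hω).and_eventually (eventually_gt_atTop 0)).exists
    exact ⟨n, (lt_birkhoffAverage_iff g hn0 ω).1 hn⟩
  have hae : {ω | ∃ n, 0 < birkhoffSum τ (fun ω => g ω - b) n ω} =ᵐ[μ.restrict E] Set.univ :=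
    eventuallyEq_univ.2 (ae_restrict_of_forall_mem hE hsub)
  rw [setIntegral_congr_set hae, setIntegral_univ] at h
  rw [integral_sub hg.integrableOn (integrable_const b), setIntegral_const, smul_eq_mul,
    sub_nonneg] at h
  rwa [mul_comm]

end

/-! ### The vector-valued Birkhoff theorem and the two-index lemma -/

section

variable {Ω X : Type*} {mΩ : MeasurableSpace Ω} {μ : Measure Ω}
  [NormedAddCommGroup X] [NormedSpace ℝ X] {τ : Ω → Ω}

/-- The set of points where the upper limit of the Birkhoff averages of `g` exceeds `b`. -/
def birkhoffUpperSet (τ : Ω → Ω) (g : Ω → ℝ) (b : ℝ) : Set Ω :=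
  {ω | ∃ c : ℚ, b < c ∧ ∃ᶠ n in atTop, (c : ℝ) < birkhoffAverage ℝ τ g n ω}

/-- The rational level strictly above `b` leaves room for a second one below it, and this gap
absorbs the vanishing difference. -/
theorem mem_birkhoffUpperSet_of_tendsto_sub {g : Ω → ℝ} {b : ℝ} {x y : Ω}
    (h : Tendsto (fun n => birkhoffAverage ℝ τ g n x - birkhoffAverage ℝ τ g n y) atTop (𝓝 0))
    (hx : x ∈ birkhoffUpperSet τ g b) : y ∈ birkhoffUpperSet τ g b := by
  obtain ⟨c, hc, hfreq⟩ := hx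
  obtain ⟨d, hbd, hdc⟩ := exists_rat_btwn hc
  refine ⟨d, hbd, (hfreq.and_eventually (h.eventually_lt_const (sub_pos.2 hdc))).mono ?_⟩
  rintro n ⟨h1, h2⟩
  linarith

/-- The averages at $\omega$ and $\tau\omega$ differ by $(g(\tau^n\omega)-g(\omega))/n$, which tends
to zero because $g$ is bounded. -/
theorem preimage_birkhoffUpperSet {g : Ω → ℝ} (hg : Bornology.IsBounded (Set.range g)) (b : ℝ) :
    τ ⁻¹' birkhoffUpperSet τ g b = birkhoffUpperSet τ g b := by
  ext ω
  have h := tendsto_birkhoffAverage_apply_sub_birkhoffAverage' ℝ hg τ ω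
  refine ⟨fun hω => mem_birkhoffUpperSet_of_tendsto_sub h hω,
    fun hω => mem_birkhoffUpperSet_of_tendsto_sub ?_ hω⟩
  simpa using h.neg

theorem measurableSet_birkhoffUpperSet (hτ : Measurable τ) {g : Ω → ℝ} (hg : Measurable g)
    (b : ℝ) : MeasurableSet (birkhoffUpperSet τ g b) := by
  have : birkhoffUpperSet τ g b = ⋃ c : ℚ, ⋃ _ : b < c, ⋂ m : ℕ, ⋃ n : ℕ, ⋃ _ : m ≤ n,
      {ω | (c : ℝ) < birkhoffAverage ℝ τ g n ω} := by
    ext ω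
    simp [birkhoffUpperSet, frequently_atTop]
  rw [this]
  refine .iUnion fun c => .iUnion fun _ => .iInter fun m => .iUnion fun n => .iUnion fun _ =>
    measurableSet_lt measurable_const ?_
  exact (Finset.measurable_sum _ fun i _ => hg.comp (hτ.iterate i)).const_smul (n : ℝ)⁻¹

/-- On this invariant set $E$ the mean inequality, applied to $g$ and to $-g$, gives
$b\,\mu(E)\le\int_E g\le a\,\mu(E)$ with $a<b$. -/
theorem MeasurePreserving.measure_birkhoffUpperSet_inter [IsFiniteMeasure μ]
    (hτ : MeasurePreserving τ μ μ) {g : Ω → ℝ} (hg : Measurable g)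
    (hbdd : Bornology.IsBounded (Set.range g)) {a b : ℝ} (hab : a < b) :
    μ (birkhoffUpperSet τ g b ∩ birkhoffUpperSet τ (-g) (-a)) = 0 := by
  set E := birkhoffUpperSet τ g b ∩ birkhoffUpperSet τ (-g) (-a)
  have hbdd' : Bornology.IsBounded (Set.range (-g)) := by
    obtain ⟨C, hC⟩ := isBounded_iff_forall_norm_le.1 hbdd
    refine isBounded_iff_forall_norm_le.2 ⟨C, ?_⟩
    rintro _ ⟨ω, rfl⟩
    simpa using hC _ ⟨ω, rfl⟩
  have hE : MeasurableSet E := (measurableSet_birkhoffUpperSet hτ.measurable hg b).inter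
    (measurableSet_birkhoffUpperSet hτ.measurable hg.neg (-a))
  have hinv : τ ⁻¹' E = E := by
    rw [Set.preimage_inter, preimage_birkhoffUpperSet hbdd, preimage_birkhoffUpperSet hbdd']
  have hgi : Integrable g μ := by
    obtain ⟨C, hC⟩ := isBounded_iff_forall_norm_le.1 hbdd
    exact .of_bound hg.aestronglyMeasurable C (ae_of_all _ fun ω => hC _ ⟨ω, rfl⟩)
  have hfreq : ∀ {h : Ω → ℝ} {c : ℝ}, ∀ ω ∈ birkhoffUpperSet τ h c,
      ∃ᶠ n in atTop, c < birkhoffAverage ℝ τ h n ω := by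
    rintro h c ω ⟨q, hq, hf⟩
    exact hf.mono fun n hn => hq.trans hn
  have h1 := hτ.const_mul_measureReal_le_setIntegral hgi hg hE hinv
    fun ω hω => hfreq ω hω.1
  have h2 := hτ.const_mul_measureReal_le_setIntegral hgi.neg hg.neg hE hinv
    fun ω hω => hfreq ω hω.2
  simp only [Pi.neg_apply, integral_neg] at h2
  have h3 : μ.real E = 0 := by
    have := measureReal_nonneg (μ := μ) (s := E)
    nlinarith
  exact (measureReal_eq_zero_iff).1 h3

/-- Birkhoff's ergodic theorem for bounded real functions. -/
theorem MeasurePreserving.ae_exists_tendsto_birkhoffAverage_of_isBounded [IsFiniteMeasure μ]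
    (hτ : MeasurePreserving τ μ μ) {g : Ω → ℝ} (hg : Measurable g)
    (hbdd : Bornology.IsBounded (Set.range g)) :
    ∀ᵐ ω ∂μ, ∃ c, Tendsto (fun n => birkhoffAverage ℝ τ g n ω) atTop (𝓝 c) := by
  have hnot : ∀ᵐ ω ∂μ, ∀ a b : ℚ, (a : ℝ) < b →
      ω ∉ birkhoffUpperSet τ g b ∩ birkhoffUpperSet τ (-g) (-a) := by
    refine ae_all_iff.2 fun a => ae_all_iff.2 fun b => ?_
    by_cases hab : (a : ℝ) < b
    · filter_upwards [measure_eq_zero_iff_ae_notMem.1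
        (hτ.measure_birkhoffUpperSet_inter hg hbdd hab)] with ω hω _ using hω
    · exact ae_of_all _ fun ω h => absurd h hab
  obtain ⟨C, hC⟩ := isBounded_iff_forall_norm_le.1 hbdd
  filter_upwards [hnot] with ω hω
  have hle : ∀ n, |birkhoffAverage ℝ τ g n ω| ≤ C := fun n =>
    norm_birkhoffAverage_le_of_forall_le ((norm_nonneg (g ω)).trans (hC _ ⟨ω, rfl⟩))
      (fun i => hC _ ⟨_, rfl⟩) n
  refine tendsto_of_no_upcrossings dense_univ ?_
    (isBoundedUnder_of ⟨C, fun n => (abs_le.1 (hle n)).2⟩)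
    (isBoundedUnder_of ⟨-C, fun n => (abs_le.1 (hle n)).1⟩)
  rintro a - b - hab ⟨h1, h2⟩
  -- Rationals $a<a_1<a_0<b_1<b_2<b$: the inner pair selects the null set, the outer pair gives the
  -- strict gaps that `birkhoffUpperSet` demands.
  obtain ⟨a₀, ha, ha₀⟩ := exists_rat_btwn hab
  obtain ⟨a₁, ha₁, ha₁'⟩ := exists_rat_btwn ha
  obtain ⟨b₁, hb₁, hb₁'⟩ := exists_rat_btwn ha₀
  obtain ⟨b₂, hb₂, hb₂'⟩ := exists_rat_btwn hb₁'
  refine hω a₀ b₁ hb₁ ⟨⟨b₂, hb₂, h2.mono fun n hn => hb₂'.trans hn⟩,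
    ⟨-a₁, by push_cast; linarith, h1.mono fun n hn => ?_⟩⟩
  rw [birkhoffAverage_neg]
  push_cast
  simp only [Pi.neg_apply]
  linarith

theorem MeasurePreserving.ae_cauchySeq_birkhoffAverage_simpleFunc [IsFiniteMeasure μ]
    (hτ : MeasurePreserving τ μ μ) (g : SimpleFunc Ω X) :
    ∀ᵐ ω ∂μ, CauchySeq fun n => birkhoffAverage ℝ τ g n ω := by
  induction g using SimpleFunc.induction with
  | const c hs =>
    rename_i s
    have hbdd : Bornology.IsBounded (Set.range (s.indicator (1 : Ω → ℝ))) := by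
      refine isBounded_iff_forall_norm_le.2 ⟨1, ?_⟩
      rintro _ ⟨ω, rfl⟩
      exact (norm_indicator_le_norm_self _ _).trans (by simp)
    filter_upwards [hτ.ae_exists_tendsto_birkhoffAverage_of_isBounded
      (measurable_one.indicator hs) hbdd] with ω ⟨a, ha⟩
    refine ((ha.smul_const c).congr fun n => ?_).cauchySeq
    simp only [birkhoffAverage, birkhoffSum, smul_eq_mul, mul_smul, Finset.sum_smul]
    congr 1
    refine Finset.sum_congr rfl fun i _ => ?_
    by_cases h : τ^[i] ω ∈ s <;> simp [h]
  | add hdisj hf hg =>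
    filter_upwards [hf, hg] with ω h1 h2
    convert h1.add h2 using 1
    ext n
    simp [birkhoffAverage_add]

/-- Birkhoff's ergodic theorem for Bochner integrable functions, almost everywhere convergence. -/
theorem MeasurePreserving.ae_cauchySeq_birkhoffAverage [IsFiniteMeasure μ]
    (hτ : MeasurePreserving τ μ μ) {g : Ω → X} (hg : Integrable g μ) :
    ∀ᵐ ω ∂μ, CauchySeq fun n => birkhoffAverage ℝ τ g n ω := by
  refine ae_cauchySeq_of_approx fun ε hε => ?_
  -- An $L_1$ error below $\varepsilon^2$ makes the weak type bound at level $\varepsilon$ give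
  -- measure at most $\varepsilon$.
  have hε2 : ENNReal.ofReal (ε * ε) ≠ 0 := by simpa using mul_pos hε hε
  obtain ⟨s, hs, hsL⟩ := (memLp_one_iff_integrable.2 hg).exists_simpleFunc_eLpNorm_sub_lt
    ENNReal.one_ne_top hε2
  refine ⟨fun n => birkhoffAverage ℝ τ s n, hτ.ae_cauchySeq_birkhoffAverage_simpleFunc s, ?_⟩
  have h := (hτ.mul_measure_exists_lt_norm_birkhoffAverage_le
    (hg.sub (memLp_one_iff_integrable.1 hsL)) hε).trans hs.le
  rw [birkhoffAverage_sub, ENNReal.ofReal_mul hε.le] at h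
  exact (ENNReal.mul_le_mul_iff_right (by simpa using hε) ENNReal.ofReal_ne_top).1 h

/-- Averaging preserves both the uniform bound of a simple approximant and its $L_p$ distance to
`g`. -/
theorem MeasurePreserving.unifIntegrable_birkhoffAverage [IsFiniteMeasure μ]
    (hτ : MeasurePreserving τ μ μ) {p : ENNReal} (hp : 1 ≤ p) (hp' : p ≠ ⊤) {g : Ω → X}
    (hg : MemLp g p μ) : UnifIntegrable (birkhoffAverage ℝ τ g) p μ := by
  refine unifIntegrable_of_approx_bounded hp hp'
    (fun n => hτ.aestronglyMeasurable_birkhoffAverage hg.1 n) fun ε hε => ?_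
  obtain ⟨s, hs, hsL⟩ := hg.exists_simpleFunc_eLpNorm_sub_lt hp' hε.ne'
  obtain ⟨C, hC⟩ := s.exists_forall_norm_le
  refine ⟨birkhoffAverage ℝ τ s, max C 0,
    fun n => hτ.aestronglyMeasurable_birkhoffAverage hsL.1 n, fun n => ae_of_all _ fun ω =>
      norm_birkhoffAverage_le_of_forall_le (le_max_right _ _)
        (fun i => (hC _).trans (le_max_left _ _)) n, fun n => ?_⟩
  have := hτ.eLpNorm_birkhoffAverage_le (hg.1.sub hsL.1) hp n
  rw [birkhoffAverage_sub] at this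
  exact this.trans hs.le

theorem ergAvg_eq_birkhoffAverage (τ : Ω → Ω) (n : ℕ) (g : Ω → X) :
    ergAvg τ n g = birkhoffAverage ℝ τ g n := by
  have hiter : ∀ i (h : Ω → X), (fun h : Ω → X => h ∘ τ)^[i] h = h ∘ τ^[i] := by
    intro i
    induction i with
    | zero => simp
    | succ i ih => intro h; rw [Function.iterate_succ_apply, ih, Function.iterate_succ']; rfl
  ext ω
  simp [ergAvg, birkhoffAverage, birkhoffSum, hiter]

theorem MeasurePreserving.integral_ergAvg (hτ : MeasurePreserving τ μ μ) {g : Ω → X}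
    (hg : Integrable g μ) {n : ℕ} (hn : n ≠ 0) :
    ∫ ω, ergAvg τ n g ω ∂μ = ∫ ω, g ω ∂μ := by
  have hi : ∀ i, ∫ ω, g (τ^[i] ω) ∂μ = ∫ ω, g ω ∂μ := fun i => by
    have := (hτ.iterate i).map_eq
    conv_rhs => rw [← this]
    exact (integral_map (hτ.iterate i).measurable.aemeasurable
      (by rw [this]; exact hg.aestronglyMeasurable)).symm
  simp only [ergAvg_eq_birkhoffAverage, birkhoffAverage, birkhoffSum]
  rw [integral_smul, integral_finsetSum (f := fun i ω => g (τ^[i] ω)) _ fun i _ =>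
    (hτ.iterate i).integrable_comp_of_integrable hg]
  simp only [hi, Finset.sum_const, Finset.card_range]
  rw [← Nat.cast_smul_eq_nsmul ℝ, smul_smul, inv_mul_cancel₀ (by exact_mod_cast hn), one_smul]

/-- The `L^p` norm does not increase when passing to the limit of the ergodic averages. -/
theorem MeasurePreserving.eLpNorm_ergLimit_le (hτ : MeasurePreserving τ μ μ) {p : ENNReal}
    (hp : 1 ≤ p) {g : Ω → X} (hg : AEStronglyMeasurable g μ)
    (hlim : ∀ᵐ ω ∂μ, Tendsto (fun n : ℕ => ergAvg τ n g ω) atTop (𝓝 (ergLimit τ g ω))) :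
    eLpNorm (ergLimit τ g) p μ ≤ eLpNorm g p μ := by
  simp only [ergAvg_eq_birkhoffAverage] at hlim
  refine (Lp.eLpNorm_lim_le_liminf_eLpNorm
    (fun n => hτ.aestronglyMeasurable_birkhoffAverage hg n) _ hlim).trans ?_
  refine liminf_le_of_le ?_ fun b hb => ?_
  · exact isBounded_ge_of_bot
  · obtain ⟨n, hn⟩ := hb.exists
    exact hn.trans (hτ.eLpNorm_birkhoffAverage_le hg hp n)

/-- The ergodic theorem of Birkhoff for functions in `L^p` with values in a Banach space:
convergence almost everywhere and in `L^p`. -/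
theorem MeasurePreserving.hasErgLimit [CompleteSpace X] [IsFiniteMeasure μ]
    (hτ : MeasurePreserving τ μ μ) {p : ENNReal} (hp : 1 ≤ p) (hp' : p ≠ ⊤) {g : Ω → X}
    (hg : MemLp g p μ) : HasErgLimit μ p τ g := by
  have hlim : ∀ᵐ ω ∂μ, Tendsto (fun n : ℕ => ergAvg τ n g ω) atTop (𝓝 (ergLimit τ g ω)) := by
    filter_upwards [hτ.ae_cauchySeq_birkhoffAverage (hg.integrable hp)] with ω hω
    simp only [ergLimit, ergAvg_eq_birkhoffAverage]
    exact hω.tendsto_limUnder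
  have hm : ∀ n, AEStronglyMeasurable (ergAvg τ n g) μ := fun n => by
    rw [ergAvg_eq_birkhoffAverage]
    exact hτ.aestronglyMeasurable_birkhoffAverage hg.1 n
  have hLp : MemLp (ergLimit τ g) p μ := ⟨aestronglyMeasurable_of_tendsto_ae atTop hm hlim,
    (hτ.eLpNorm_ergLimit_le hp hg.1 hlim).trans_lt hg.2⟩
  refine ⟨hLp, hlim, tendsto_Lp_finite_of_tendsto_ae hp hp' hm hLp ?_ hlim⟩
  simp only [ergAvg_eq_birkhoffAverage]
  exact hτ.unifIntegrable_birkhoffAverage hp hp' hg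

/-- If `h n → 0` almost everywhere with integrable supremum, then the averages `S_k (h n)` tend to
zero almost everywhere as `k, n → ∞` independently. -/
theorem MeasurePreserving.ae_tendsto_birkhoffAverage_prod [IsFiniteMeasure μ]
    (hτ : MeasurePreserving τ μ μ) {h : ℕ → Ω → X} (hm : ∀ n, AEStronglyMeasurable (h n) μ)
    (h0 : ∀ᵐ ω ∂μ, Tendsto (fun n => h n ω) atTop (𝓝 0))
    (hsup : ∫⁻ ω, ⨆ n, ‖h n ω‖ₑ ∂μ ≠ ⊤) :
    ∀ᵐ ω ∂μ, Tendsto (fun q : ℕ × ℕ => birkhoffAverage ℝ τ (h q.2) q.1 ω)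
      (atTop ×ˢ atTop) (𝓝 0) := by
  -- The tail suprema decrease to zero a.e. and are dominated by the full supremum, so their
  -- integrals tend to zero.
  set G : ℕ → Ω → ENNReal := fun k ω => ⨆ n, ‖h (n + k) ω‖ₑ with hG
  have hGm : ∀ k, AEMeasurable (G k) μ := fun k => .iSup fun n => (hm _).enorm
  have hGle : ∀ k ω, G k ω ≤ ⨆ n, ‖h n ω‖ₑ := fun k ω =>
    iSup_le fun n => le_iSup (fun n => ‖h n ω‖ₑ) (n + k)
  have hGfin : ∀ k, ∫⁻ ω, G k ω ∂μ ≠ ⊤ := fun k =>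
    ne_top_of_le_ne_top hsup (lintegral_mono (hGle k))
  have hG0 : Tendsto (fun k => ∫⁻ ω, G k ω ∂μ) atTop (𝓝 0) := by
    rw [← lintegral_zero (μ := μ)]
    refine tendsto_lintegral_of_dominated_convergence' _ hGm
      (fun k => ae_of_all _ (hGle k)) hsup ?_
    filter_upwards [h0] with ω hω
    refine ENNReal.tendsto_nhds_zero.2 fun ε hε => ?_
    have := ENNReal.tendsto_nhds_zero.1 (by simpa using hω.enorm) ε hε
    obtain ⟨N, hN⟩ := eventually_atTop.1 this
    filter_upwards [eventually_ge_atTop N] with k hk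
    exact iSup_le fun n => hN _ (by omega)
  have hGtop : ∀ k, ∀ᵐ ω ∂μ, G k ω < ⊤ := fun k => ae_lt_top' (hGm k) (hGfin k)
  have hGi : ∀ k, Integrable (fun ω => (G k ω).toReal) μ := fun k =>
    integrable_toReal_of_lintegral_ne_top (hGm k) (hGfin k)
  -- `G k` must be finite along the whole orbit for `toReal` to preserve the bound; this holds a.e.
  -- since the iterates of $\tau$ pull null sets back to null sets.
  have hdom : ∀ᵐ ω ∂μ, ∀ k n, k ≤ n → ∀ j, ‖birkhoffAverage ℝ τ (h n) j ω‖ ≤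
      ‖birkhoffAverage ℝ τ (fun ω => (G k ω).toReal) j ω‖ := by
    filter_upwards [ae_all_iff.2 fun k => ae_all_iff.2 fun i =>
      (hτ.iterate i).quasiMeasurePreserving.ae (hGtop k)] with ω hω k n hkn j
    refine (norm_birkhoffAverage_le _ _ _).trans
      ((birkhoffAverage_mono (fun i => ?_) j).trans (le_abs_self _))
    rw [← toReal_enorm]
    refine ENNReal.toReal_mono (hω k i).ne ?_
    obtain ⟨d, rfl⟩ := Nat.exists_eq_add_of_le' hkn
    exact le_iSup (fun n => ‖h (n + k) (τ^[i] ω)‖ₑ) d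
  have key : ∀ᵐ ω ∂μ, ∀ ε, 0 < ε → ∃ k, ∀ j n, k ≤ n → ‖birkhoffAverage ℝ τ (h n) j ω‖ ≤ ε := by
    refine ae_forall_pos_of_measure_le
      (fun ε ε' ω hle ⟨k, hk⟩ => ⟨k, fun j n hn => (hk j n hn).trans hle⟩) fun ε hε => ?_
    obtain ⟨k, hk⟩ := (ENNReal.tendsto_nhds_zero.1 hG0 (ENNReal.ofReal (ε * ε))
      (by simpa using mul_pos hε hε)).exists
    -- A single maximal inequality, for `G k`, controls all averages of all `h n` with `n ≥ k`; this
    -- makes the two indices independent.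
    have hmax := hτ.mul_measure_exists_lt_norm_birkhoffAverage_le (hGi k) hε
    have hnorm : eLpNorm (fun ω => (G k ω).toReal) 1 μ ≤ ENNReal.ofReal (ε * ε) := by
      rw [eLpNorm_one_eq_lintegral_enorm]
      refine (lintegral_mono fun ω => ?_).trans hk
      rw [Real.enorm_of_nonneg ENNReal.toReal_nonneg]
      exact ENNReal.ofReal_toReal_le
    replace hmax := hmax.trans hnorm
    rw [ENNReal.ofReal_mul hε.le] at hmax
    refine le_trans (measure_mono_ae ?_)
      ((ENNReal.mul_le_mul_iff_right (by simpa using hε) ENNReal.ofReal_ne_top).1 hmax)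
    filter_upwards [hdom] with ω hω hnot
    by_contra hle
    exact hnot ⟨k, fun j n hn => (hω k n hn j).trans (not_lt.1 fun hlt => hle ⟨j, hlt⟩)⟩
  filter_upwards [key] with ω hω
  refine Metric.tendsto_nhds.2 fun ε hε => ?_
  obtain ⟨k, hk⟩ := hω (ε / 2) (by positivity)
  filter_upwards [tendsto_snd.eventually (eventually_ge_atTop k)] with q hq
  rw [dist_zero_right]
  exact (hk _ _ hq).trans_lt (by linarith)

end

/-! ### Convergence of conditional expectations in $L_1$ -/

section

variable {Ω X : Type*} {m m' Finf mΩ : MeasurableSpace Ω} {μ : Measure Ω} {F : ℕ → MeasurableSpace Ω}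

/-- The limsup of the `F n`-measurable versions ignores any initial segment, so it is measurable for
every `F N`; a.e. all versions equal `h`. -/
theorem aestronglyMeasurable_iInf_of_antitone (hF : Antitone F) {h : Ω → ℝ}
    (hm : ∀ n, AEStronglyMeasurable[F n] h μ) : AEStronglyMeasurable[⨅ n, F n] h μ := by
  have hk : ∀ n, StronglyMeasurable[F n] ((hm n).mk h) := fun n => (hm n).stronglyMeasurable_mk
  refine ⟨fun ω => limsup (fun n => (hm n).mk h ω) atTop, ?_, ?_⟩
  · suffices Measurable[⨅ n, F n] fun ω => limsup (fun n => (hm n).mk h ω) atTop from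
      this.stronglyMeasurable
    intro s hs
    refine MeasurableSpace.measurableSet_iInf.2 fun N => ?_
    have hN : Measurable[F N] fun ω => limsup (fun n => (hm (n + N)).mk h ω) atTop :=
      Measurable.limsup fun n =>
        (hk (n + N)).measurable.mono (hF (Nat.le_add_left N n)) le_rfl
    have heq : (fun ω => limsup (fun n => (hm n).mk h ω) atTop) =
        fun ω => limsup (fun n => (hm (n + N)).mk h ω) atTop := by
      ext ω
      exact (limsup_nat_add (fun n => (hm n).mk h ω) N).symm
    rw [heq]
    exact hN hs
  · filter_upwards [ae_all_iff.2 fun n => (hm n).ae_eq_mk] with ω hω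
    simp [← hω]

/-- Orthogonal projections onto a decreasing sequence of complete subspaces converge strongly. -/
theorem _root_.Submodule.exists_tendsto_starProjection_of_antitone {H : Type*}
    [NormedAddCommGroup H] [InnerProductSpace ℝ H] [CompleteSpace H] (U : ℕ → Submodule ℝ H)
    [∀ i, (U i).HasOrthogonalProjection] (hU : Antitone U) (hcl : ∀ i, IsClosed (U i : Set H))
    (x : H) : ∃ y, (∀ i, y ∈ U i) ∧ Tendsto (fun i => (U i).starProjection x) atTop (𝓝 y) := by
  -- The orthogonal complements increase, so their projections converge; subtracting from the
  -- identity returns to `U`.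
  have h := Submodule.starProjection_tendsto_closure_iSup (fun i => (U i)ᗮ)
    (fun i j hij => Submodule.orthogonal_le (hU hij)) x
  have h2 := h.const_sub x
  simp only [Submodule.starProjection_orthogonal', sub_sub_cancel, _root_.sub_apply,
    one_apply_eq_self] at h2
  exact ⟨_, fun i => (hcl i).mem_of_tendsto h2 <| (eventually_ge_atTop i).mono fun j hj =>
    hU hj (Submodule.starProjection_apply_mem _ x), h2⟩

theorem exists_tendsto_eLpNorm_condExp_of_antitone [IsFiniteMeasure μ] (hle : ∀ n, F n ≤ mΩ)
    (hF : Antitone F) {g : Ω → ℝ} (hg : MemLp g 2 μ) :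
    ∃ h : Ω → ℝ, MemLp h 2 μ ∧ (∀ n, AEStronglyMeasurable[F n] h μ) ∧
      Tendsto (fun n => eLpNorm (μ[g | F n] - h) 2 μ) atTop (𝓝 0) := by
  have : ∀ n, Fact (F n ≤ mΩ) := fun n => ⟨hle n⟩
  obtain ⟨y, hy, hlim⟩ := Submodule.exists_tendsto_starProjection_of_antitone
    (fun n => lpMeas ℝ ℝ (F n) 2 μ)
    (fun i j hij x hx => mem_lpMeas_iff_aestronglyMeasurable.2
      ((mem_lpMeas_iff_aestronglyMeasurable.1 hx).mono (hF hij)))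
    (fun n => isClosed_aestronglyMeasurable (hle n)) (hg.toLp g)
  refine ⟨y, Lp.memLp y, fun n => mem_lpMeas_iff_aestronglyMeasurable.1 (hy n), ?_⟩
  rw [Lp.tendsto_Lp_iff_tendsto_eLpNorm'] at hlim
  refine hlim.congr fun n => eLpNorm_congr_ae ?_
  have : ((lpMeas ℝ ℝ (F n) 2 μ).starProjection (hg.toLp g) : Ω → ℝ) =ᵐ[μ] μ[g | F n] :=
    hg.condExpL2_ae_eq_condExp (𝕜 := ℝ) (hle n)
  filter_upwards [this] with ω hω
  simp [hω]

/-- **Lévy's downward theorem** for real square integrable functions: convergence in `L^1`. -/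
theorem tendsto_eLpNorm_one_condExp_iInf [IsFiniteMeasure μ] (hle : ∀ n, F n ≤ mΩ)
    (hF : Antitone F) {g : Ω → ℝ} (hg : MemLp g 2 μ) :
    Tendsto (fun n => eLpNorm (μ[g | F n] - μ[g | ⨅ n, F n]) 1 μ) atTop (𝓝 0) := by
  obtain ⟨h, hh, hmeas, hlim⟩ := exists_tendsto_eLpNorm_condExp_of_antitone hle hF hg
  have hgi : Integrable g μ := hg.integrable one_le_two
  have hhi : Integrable h μ := hh.integrable one_le_two
  have hinf : ⨅ n, F n ≤ mΩ := (iInf_le _ 0).trans (hle 0)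
  have hlim1 : Tendsto (fun n => eLpNorm (μ[g | F n] - h) 1 μ) atTop (𝓝 0) := by
    have hbound : ∀ n, eLpNorm (μ[g | F n] - h) 1 μ ≤ eLpNorm (μ[g | F n] - h) 2 μ *
        μ Set.univ ^ (1 / (1 : ENNReal).toReal - 1 / (2 : ENNReal).toReal) := fun n =>
      eLpNorm_le_eLpNorm_mul_rpow_measure_univ one_le_two
        (integrable_condExp.sub hhi).aestronglyMeasurable
    refine tendsto_of_tendsto_of_tendsto_of_le_of_le tendsto_const_nhds ?_
      (fun _ => zero_le) hbound
    rw [← zero_mul (μ Set.univ ^ (1 / (1 : ENNReal).toReal - 1 / (2 : ENNReal).toReal))]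
    refine ENNReal.Tendsto.mul_const hlim (Or.inr ?_)
    exact ENNReal.rpow_ne_top_of_nonneg (by norm_num) (measure_ne_top _ _)
  -- Over a set in every `F n`, the integral of `μ[g | F n]` does not depend on `n`, so the $L_1$
  -- limit has the defining property of the conditional expectation.
  have heq : h =ᵐ[μ] μ[g | ⨅ n, F n] := by
    refine ae_eq_condExp_of_forall_setIntegral_eq hinf hgi (fun s _ _ => hhi.integrableOn)
      (fun s hs _ => ?_) (aestronglyMeasurable_iInf_of_antitone hF hmeas)
    have h1 : Tendsto (fun n => ∫ ω in s, (μ[g | F n]) ω ∂μ) atTop (𝓝 (∫ ω in s, h ω ∂μ)) :=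
      tendsto_setIntegral_of_L1' h hhi.aestronglyMeasurable
        (Eventually.of_forall fun n => integrable_condExp) hlim1 s
    refine tendsto_nhds_unique h1 (tendsto_const_nhds.congr fun n => ?_)
    exact (setIntegral_condExp (hle n) hgi (MeasurableSpace.measurableSet_iInf.1 hs n)).symm
  refine hlim1.congr fun n => eLpNorm_congr_ae ?_
  filter_upwards [heq] with ω hω
  simp [hω]

theorem _root_.MonotoneSigmaLimit.le (hlim : MonotoneSigmaLimit F Finf)
    (hle : ∀ n, F n ≤ mΩ) : Finf ≤ mΩ := by
  rcases hlim with ⟨-, rfl⟩ | ⟨-, rfl⟩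
  · exact iSup_le hle
  · exact (iInf_le _ 0).trans (hle 0)

theorem tendsto_eLpNorm_one_condExp_real [IsFiniteMeasure μ]
    (hle : ∀ n, F n ≤ mΩ) (hlim : MonotoneSigmaLimit F Finf) {g : Ω → ℝ} (hg : MemLp g 2 μ) :
    Tendsto (fun n => eLpNorm (μ[g | F n] - μ[g | Finf]) 1 μ) atTop (𝓝 0) := by
  rcases hlim with ⟨hF, rfl⟩ | ⟨hF, rfl⟩
  · exact tendsto_eLpNorm_condExp (ℱ := ⟨F, hF, hle⟩) g
  · exact tendsto_eLpNorm_one_condExp_iInf hle hF hg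

variable [NormedAddCommGroup X] [NormedSpace ℝ X] [CompleteSpace X]

theorem aestronglyMeasurable_condExp_sub {f g : Ω → X} :
    AEStronglyMeasurable (μ[f | m] - μ[g | m']) μ :=
  (integrable_condExp.sub integrable_condExp).aestronglyMeasurable

theorem tendsto_eLpNorm_one_condExp_simpleFunc [IsFiniteMeasure μ]
    (hle : ∀ n, F n ≤ mΩ) (hlim : MonotoneSigmaLimit F Finf) (g : SimpleFunc Ω X) :
    Tendsto (fun n => eLpNorm (μ[g | F n] - μ[g | Finf]) 1 μ) atTop (𝓝 0) := by
  induction g using SimpleFunc.induction with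
  | const c hs =>
    rename_i s
    set g : Ω → ℝ := s.indicator 1
    have hg : MemLp g 2 μ := (memLp_const (1 : ℝ)).indicator hs
    set T : ℝ →L[ℝ] X := ContinuousLinearMap.toSpanSingleton ℝ c
    have hT : ∀ m : MeasurableSpace Ω, T ∘ μ[g | m] =ᵐ[μ] μ[T ∘ g | m] := fun m =>
      T.comp_condExp_comm (hg.integrable one_le_two)
    have hTg : T ∘ g = SimpleFunc.piecewise s hs (SimpleFunc.const Ω c) (SimpleFunc.const Ω 0) := by
      ext ω
      by_cases h : ω ∈ s <;> simp [g, T, h]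
    rw [← hTg]
    have hbound : ∀ n, eLpNorm (μ[T ∘ g | F n] - μ[T ∘ g | Finf]) 1 μ ≤
        ENNReal.ofReal ‖c‖ * eLpNorm (μ[g | F n] - μ[g | Finf]) 1 μ := fun n => by
      refine eLpNorm_le_mul_eLpNorm_of_ae_le_mul ?_ 1
      filter_upwards [hT (F n), hT Finf] with ω h1 h2
      simp only [Pi.sub_apply, ← h1, ← h2, Function.comp_apply]
      rw [← map_sub, ContinuousLinearMap.toSpanSingleton_apply, norm_smul, mul_comm]
    refine tendsto_of_tendsto_of_tendsto_of_le_of_le tendsto_const_nhds ?_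
      (fun _ => zero_le) hbound
    simpa using ENNReal.Tendsto.const_mul (a := ENNReal.ofReal ‖c‖)
      (tendsto_eLpNorm_one_condExp_real hle hlim hg)
      (Or.inr ENNReal.ofReal_ne_top)
  | add hdisj hf hg =>
    rename_i f g
    have hfi : Integrable f μ := f.integrable_of_isFiniteMeasure
    have hgi : Integrable g μ := g.integrable_of_isFiniteMeasure
    refine tendsto_of_tendsto_of_tendsto_of_le_of_le tendsto_const_nhds
      (by simpa using hf.add hg) (fun _ => zero_le) fun n => ?_
    refine le_trans (eLpNorm_congr_ae ?_).le (eLpNorm_add_le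
      (integrable_condExp.sub integrable_condExp).aestronglyMeasurable
      (integrable_condExp.sub integrable_condExp).aestronglyMeasurable le_rfl)
    rw [SimpleFunc.coe_add]
    filter_upwards [condExp_add hfi hgi (F n), condExp_add hfi hgi Finf] with ω h1 h2
    simp only [Pi.sub_apply, Pi.add_apply, h1, h2]
    abel

theorem eLpNorm_condExp_sub_condExp_le {p : ENNReal} (hp : 1 ≤ p) {f g : Ω → X}
    (hf : Integrable f μ) (hg : Integrable g μ) :
    eLpNorm (μ[f | m] - μ[g | m]) p μ ≤ eLpNorm (f - g) p μ :=
  (eLpNorm_congr_ae (condExp_sub hf hg _).symm).trans_le (eLpNorm_condExp_le_eLpNorm _ hp)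

/-- Martingale convergence in `L^1` for closed martingales and reverse martingales in a Banach
space. -/
theorem tendsto_eLpNorm_one_condExp [IsFiniteMeasure μ]
    (hle : ∀ n, F n ≤ mΩ) (hlim : MonotoneSigmaLimit F Finf) {f : Ω → X} (hf : Integrable f μ) :
    Tendsto (fun n => eLpNorm (μ[f | F n] - μ[f | Finf]) 1 μ) atTop (𝓝 0) := by
  refine ENNReal.tendsto_nhds_zero.2 fun ε hε => ?_
  have hε3 : ε / 3 ≠ 0 := (ENNReal.div_pos hε.ne' (by simp)).ne'
  obtain ⟨s, hs, hsL⟩ := (memLp_one_iff_integrable.2 hf).exists_simpleFunc_eLpNorm_sub_lt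
    ENNReal.one_ne_top hε3
  have hsi : Integrable s μ := memLp_one_iff_integrable.1 hsL
  filter_upwards [ENNReal.tendsto_nhds_zero.1
    (tendsto_eLpNorm_one_condExp_simpleFunc (μ := μ) hle hlim s) (ε / 3) (pos_iff_ne_zero.2 hε3)]
    with n hn
  have hsplit : μ[f | F n] - μ[f | Finf] = (μ[f | F n] - μ[s | F n]) +
      ((μ[s | F n] - μ[s | Finf]) + (μ[s | Finf] - μ[f | Finf])) := by abel
  calc eLpNorm (μ[f | F n] - μ[f | Finf]) 1 μ
      ≤ eLpNorm (μ[f | F n] - μ[s | F n]) 1 μ + (eLpNorm (μ[s | F n] - μ[s | Finf]) 1 μ +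
          eLpNorm (μ[s | Finf] - μ[f | Finf]) 1 μ) := by
        rw [hsplit]
        exact (eLpNorm_add_le aestronglyMeasurable_condExp_sub
          (aestronglyMeasurable_condExp_sub.add aestronglyMeasurable_condExp_sub) le_rfl).trans
          (add_le_add le_rfl (eLpNorm_add_le aestronglyMeasurable_condExp_sub
            aestronglyMeasurable_condExp_sub le_rfl))
    _ ≤ ε / 3 + (ε / 3 + ε / 3) := by
        gcongr
        · exact (eLpNorm_condExp_sub_condExp_le le_rfl hf hsi).trans hs.le
        · rw [eLpNorm_sub_comm]
          exact (eLpNorm_condExp_sub_condExp_le le_rfl hf hsi).trans hs.le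
    _ = ε := by rw [← add_assoc, ENNReal.add_thirds]

end

/-! ### Doob's inequality and martingale convergence a.e. and in $L_p$ -/

section

variable {Ω X : Type*} {m m' Finf mΩ : MeasurableSpace Ω} {μ : Measure Ω}
  {F : ℕ → MeasurableSpace Ω}
  [NormedAddCommGroup X] [NormedSpace ℝ X] [CompleteSpace X]

theorem submartingale_norm_condExp [IsFiniteMeasure μ] (𝒢 : Filtration ℕ mΩ) (g : Ω → X) :
    Submartingale (fun n ω => ‖(μ[g | 𝒢 n]) ω‖) 𝒢 μ := by
  refine ⟨fun n => stronglyMeasurable_condExp.norm, fun i j hij => ?_,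
    fun n => integrable_condExp.norm⟩
  filter_upwards [norm_condExp_le (m := 𝒢 i) (μ := μ) (μ[g | 𝒢 j]),
    condExp_condExp_of_le (μ := μ) (f := g) (𝒢.mono hij) (𝒢.le j)] with ω h1 h2
  rwa [h2] at h1

theorem mul_measure_exists_le_norm_condExp_filtration_le [IsFiniteMeasure μ]
    (𝒢 : Filtration ℕ mΩ) (g : Ω → X) {a : ℝ} (ha : 0 < a) (N : ℕ) :
    ENNReal.ofReal a * μ {ω | ∃ n ≤ N, a ≤ ‖(μ[g | 𝒢 n]) ω‖} ≤ eLpNorm g 1 μ := by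
  have h := maximal_ineq (submartingale_norm_condExp (μ := μ) 𝒢 g)
    (fun n ω => norm_nonneg _) (ε := a.toNNReal) N
  have hset : {ω | (a.toNNReal : ℝ) ≤ (Finset.range (N + 1)).sup' Finset.nonempty_range_add_one
      fun k => ‖(μ[g | 𝒢 k]) ω‖} = {ω | ∃ n ≤ N, a ≤ ‖(μ[g | 𝒢 n]) ω‖} := by
    ext ω
    simp [Finset.le_sup'_iff, ha.le]
  rw [hset] at h
  refine h.trans ?_
  calc _ ≤ ENNReal.ofReal (∫ ω, ‖(μ[g | 𝒢 N]) ω‖ ∂μ) := ENNReal.ofReal_le_ofReal <|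
        setIntegral_le_integral integrable_condExp.norm (ae_of_all _ fun ω => norm_nonneg _)
    _ = eLpNorm (μ[g | 𝒢 N]) 1 μ := by
        rw [ofReal_integral_norm_eq_lintegral_enorm integrable_condExp,
          eLpNorm_one_eq_lintegral_enorm]
    _ ≤ eLpNorm g 1 μ := eLpNorm_condExp_le_eLpNorm g le_rfl

/-- Doob's weak type `(1, 1)` maximal inequality for the conditional expectations of an integrable
function with respect to a monotone or antitone sequence of `σ`-algebras. -/
theorem mul_measure_exists_le_norm_condExp_le [IsFiniteMeasure μ] (hle : ∀ n, F n ≤ mΩ)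
    (hF : Monotone F ∨ Antitone F) (g : Ω → X) {a : ℝ} (ha : 0 < a) :
    ENNReal.ofReal a * μ {ω | ∃ n, a ≤ ‖(μ[g | F n]) ω‖} ≤ eLpNorm g 1 μ := by
  have hfin : ∀ N, ENNReal.ofReal a * μ {ω | ∃ n ≤ N, a ≤ ‖(μ[g | F n]) ω‖} ≤
      eLpNorm g 1 μ := by
    intro N
    rcases hF with hF | hF
    · exact mul_measure_exists_le_norm_condExp_filtration_le ⟨F, hF, hle⟩ g ha N
    -- Reversing time on `0, …, N` turns a decreasing sequence into a filtration; the bound is free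
    -- of `N`, so `N` can tend to infinity afterwards.
    · convert mul_measure_exists_le_norm_condExp_filtration_le (μ := μ)
        ⟨fun k => F (N - k), fun i j hij => hF (Nat.sub_le_sub_left hij N), fun k => hle _⟩
        g ha N using 5 with ω
      constructor
      · rintro ⟨n, hn, h⟩
        refine ⟨N - n, Nat.sub_le _ _, ?_⟩
        simpa [Nat.sub_sub_self hn] using h
      · rintro ⟨n, hn, h⟩
        exact ⟨N - n, Nat.sub_le _ _, h⟩
  have hunion : {ω | ∃ n, a ≤ ‖(μ[g | F n]) ω‖} =
      ⋃ N, {ω | ∃ n ≤ N, a ≤ ‖(μ[g | F n]) ω‖} := by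
    ext ω
    simp only [Set.mem_ofPred_eq, Set.mem_iUnion]
    exact ⟨fun ⟨n, h⟩ => ⟨n, n, le_rfl, h⟩, fun ⟨_, n, _, h⟩ => ⟨n, h⟩⟩
  have hmono : Monotone fun N => {ω | ∃ n ≤ N, a ≤ ‖(μ[g | F n]) ω‖} := by
    rintro M N hMN ω ⟨n, hn, h⟩
    exact ⟨n, hn.trans hMN, h⟩
  rw [hunion]
  exact le_of_tendsto' (ENNReal.Tendsto.const_mul (tendsto_measure_iUnion_atTop hmono)
    (Or.inr ENNReal.ofReal_ne_top)) hfin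

/-- Martingale convergence almost everywhere for closed martingales and reverse martingales in a
Banach space. -/
theorem ae_tendsto_condExp [IsFiniteMeasure μ] (hle : ∀ n, F n ≤ mΩ)
    (hlim : MonotoneSigmaLimit F Finf) (f : Ω → X) :
    ∀ᵐ ω ∂μ, Tendsto (fun n => (μ[f | F n]) ω) atTop (𝓝 ((μ[f | Finf]) ω)) := by
  by_cases hf : Integrable f μ
  swap
  · simp [condExp_of_not_integrable hf]
  have hL1 := tendsto_eLpNorm_one_condExp hle hlim hf
  have hcauchy : ∀ᵐ ω ∂μ, CauchySeq fun n => (μ[f | F n]) ω := by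
    refine ae_cauchySeq_of_approx fun ε hε => ?_
    have hε0 : ENNReal.ofReal ε ≠ 0 := by simpa using hε
    obtain ⟨N, hN⟩ := (ENNReal.tendsto_nhds_zero.1 hL1 (ENNReal.ofReal (ε * ε))
      (by simpa using mul_pos hε hε)).exists
    set g := μ[f | F N] - μ[f | Finf]
    have hmax : μ {ω | ∃ n, ε ≤ ‖(μ[g | F n]) ω‖} ≤ ENNReal.ofReal ε := by
      have := (mul_measure_exists_le_norm_condExp_le (μ := μ) hle
        (hlim.imp And.left And.left) g hε).trans hN
      rw [ENNReal.ofReal_mul hε.le] at this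
      exact (ENNReal.mul_le_mul_iff_right hε0 ENNReal.ofReal_ne_top).1 this
    have hsub : ∀ n, μ[g | F n] =ᵐ[μ] μ[μ[f | F N] | F n] - μ[μ[f | Finf] | F n] := fun n =>
      condExp_sub integrable_condExp integrable_condExp _
    -- By the tower property, for `n ≥ N`, `μ[g | F n]` is up to sign the distance of `μ[f | F n]`
    -- from a fixed function: `μ[f | F N]` in the increasing case, `μ[f | Finf]` in the decreasing
    -- one.
    obtain ⟨w, hw⟩ : ∃ w : Ω → X, ∀ n, N ≤ n →
        ∀ᵐ ω ∂μ, ‖(μ[f | F n]) ω - w ω‖ = ‖(μ[g | F n]) ω‖ := by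
      rcases hlim with ⟨hF, rfl⟩ | ⟨hF, rfl⟩
      · refine ⟨μ[f | F N], fun n hn => ?_⟩
        have h1 : μ[μ[f | F N] | F n] = μ[f | F N] := condExp_of_stronglyMeasurable (hle n)
          (stronglyMeasurable_condExp.mono (hF hn)) integrable_condExp
        filter_upwards [hsub n, condExp_condExp_of_le (μ := μ) (f := f) (le_iSup F n)
          (iSup_le hle)] with ω h2 h3
        rw [h2, Pi.sub_apply, h1, h3, norm_sub_rev]
      · refine ⟨μ[f | ⨅ n, F n], fun n hn => ?_⟩
        have h1 : μ[μ[f | ⨅ n, F n] | F n] = μ[f | ⨅ n, F n] :=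
          condExp_of_stronglyMeasurable (hle n)
            (stronglyMeasurable_condExp.mono (iInf_le F n)) integrable_condExp
        filter_upwards [hsub n, condExp_condExp_of_le (μ := μ) (f := f) (hF hn) (hle N)]
          with ω h2 h3
        rw [h2, Pi.sub_apply, h1, h3]
    -- The approximating sequence is exact before `N` and constant from `N` on, hence trivially
    -- Cauchy.
    refine ⟨fun n => if n < N then μ[f | F n] else w, ae_of_all _ fun ω => ?_, ?_⟩
    · refine Tendsto.cauchySeq (x := w ω) (tendsto_const_nhds.congr' ?_)
      filter_upwards [eventually_ge_atTop N] with n hn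
      simp [not_lt.2 hn]
    · refine (measure_mono_ae ?_).trans hmax
      filter_upwards [ae_all_iff.2 fun n => ae_all_iff.2 (hw n)] with ω hω
      rintro ⟨n, hn⟩
      by_cases hnN : n < N
      · simp [hnN, hε.not_gt] at hn
      · rw [if_neg hnN, hω n (not_lt.1 hnN)] at hn
        exact ⟨n, hn.le⟩
  -- $L_1$ convergence identifies the a.e. limit along a subsequence.
  obtain ⟨ns, hns, hsubseq⟩ := (tendstoInMeasure_of_tendsto_eLpNorm one_ne_zero
    (fun _ => integrable_condExp.aestronglyMeasurable) integrable_condExp.aestronglyMeasurable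
    hL1).exists_seq_tendsto_ae
  filter_upwards [hcauchy, hsubseq] with ω h1 h2
  exact tendsto_nhds_of_cauchySeq_of_subseq h1 hns.tendsto_atTop h2

theorem unifIntegrable_condExp [IsFiniteMeasure μ] {p : ENNReal}
    (hp : 1 ≤ p) (hp' : p ≠ ⊤) {f : Ω → X} (hf : MemLp f p μ) :
    UnifIntegrable (fun n => μ[f | F n]) p μ := by
  refine unifIntegrable_of_approx_bounded hp hp'
    (fun _ => integrable_condExp.aestronglyMeasurable) fun ε hε => ?_
  obtain ⟨s, hs, hsL⟩ := hf.exists_simpleFunc_eLpNorm_sub_lt hp' hε.ne'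
  obtain ⟨C, hC⟩ := s.exists_forall_norm_le
  exact ⟨fun n => μ[s | F n], C, fun _ => integrable_condExp.aestronglyMeasurable,
    fun _ => ae_bdd_norm_condExp_of_ae_bdd_norm (ae_of_all _ hC),
    fun _ => (eLpNorm_condExp_sub_condExp_le hp (hf.integrable hp) (hsL.integrable hp)).trans
      hs.le⟩

/-- Martingale convergence in `L^p` for closed martingales and reverse martingales in a Banach
space. -/
theorem tendsto_eLpNorm_condExp_sub [IsFiniteMeasure μ] (hle : ∀ n, F n ≤ mΩ)
    (hlim : MonotoneSigmaLimit F Finf) {p : ENNReal} (hp : 1 ≤ p) (hp' : p ≠ ⊤) {f : Ω → X}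
    (hf : MemLp f p μ) :
    Tendsto (fun n => eLpNorm (μ[f | F n] - μ[f | Finf]) p μ) atTop (𝓝 0) :=
  tendsto_Lp_finite_of_tendsto_ae hp hp' (fun _ => integrable_condExp.aestronglyMeasurable)
    (hf.condExp hp) (unifIntegrable_condExp hp hp' hf) (ae_tendsto_condExp hle hlim f)

end

/-! ### Combining the two limits -/

section

variable {Ω X : Type*} {m m' Finf mΩ : MeasurableSpace Ω} {μ : Measure Ω} {τ : Ω → Ω}
  {F : ℕ → MeasurableSpace Ω}
  [NormedAddCommGroup X] [NormedSpace ℝ X] [CompleteSpace X]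

theorem tendsto_eLpNorm_ergAvg_condExp [IsFiniteMeasure μ] (hτ : MeasurePreserving τ μ μ)
    (hle : ∀ n, F n ≤ mΩ) (hlim : MonotoneSigmaLimit F Finf) {p : ENNReal} (hp : 1 ≤ p)
    (hp' : p ≠ ⊤) {f : Ω → X} (hf : MemLp f p μ) :
    Tendsto (fun q : ℕ × ℕ =>
        eLpNorm (fun ω => ergAvg τ q.1 (μ[f | F q.2]) ω - ergLimit τ (μ[f | Finf]) ω) p μ)
      (atTop ×ˢ atTop) (𝓝 0) := by
  obtain ⟨hL, -, hconv⟩ := hτ.hasErgLimit hp hp' (hf.condExp (m := Finf) hp)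
  have hsum := ((tendsto_eLpNorm_condExp_sub hle hlim hp hp' hf).comp
    (tendsto_snd (f := (atTop : Filter ℕ)))).add (hconv.comp (tendsto_fst (g := (atTop : Filter ℕ))))
  rw [add_zero] at hsum
  refine tendsto_of_tendsto_of_tendsto_of_le_of_le tendsto_const_nhds hsum
    (fun _ => zero_le) fun q => ?_
  have hm : AEStronglyMeasurable (μ[f | F q.2] - μ[f | Finf]) μ :=
    aestronglyMeasurable_condExp_sub
  have hsplit : (fun ω => ergAvg τ q.1 (μ[f | F q.2]) ω - ergLimit τ (μ[f | Finf]) ω) =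
      birkhoffAverage ℝ τ (μ[f | F q.2] - μ[f | Finf]) q.1 +
        fun ω => ergAvg τ q.1 (μ[f | Finf]) ω - ergLimit τ (μ[f | Finf]) ω := by
    ext ω
    simp [ergAvg_eq_birkhoffAverage, birkhoffAverage_sub]
  rw [hsplit]
  refine (eLpNorm_add_le (hτ.aestronglyMeasurable_birkhoffAverage hm _) ?_ hp).trans
    (add_le_add (hτ.eLpNorm_birkhoffAverage_le hm hp _) le_rfl)
  rw [ergAvg_eq_birkhoffAverage]
  exact (hτ.aestronglyMeasurable_birkhoffAverage integrable_condExp.aestronglyMeasurable _).sub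
    hL.aestronglyMeasurable

theorem MeasurePreserving.integral_ergLimit [IsFiniteMeasure μ] (hτ : MeasurePreserving τ μ μ)
    {g : Ω → X} (hg : Integrable g μ) : ∫ ω, ergLimit τ g ω ∂μ = ∫ ω, g ω ∂μ := by
  obtain ⟨hL, -, hconv⟩ := hτ.hasErgLimit le_rfl ENNReal.one_ne_top (memLp_one_iff_integrable.2 hg)
  have hi : ∀ n, Integrable (ergAvg τ n g) μ := fun n => by
    rw [ergAvg_eq_birkhoffAverage, ← memLp_one_iff_integrable]
    exact ⟨hτ.aestronglyMeasurable_birkhoffAverage hg.1 n,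
      (hτ.eLpNorm_birkhoffAverage_le hg.1 le_rfl n).trans_lt (memLp_one_iff_integrable.2 hg).2⟩
  have h := tendsto_integral_of_L1' _ hL.aestronglyMeasurable (Eventually.of_forall hi) hconv
  refine tendsto_nhds_unique h (tendsto_const_nhds.congr' ?_)
  filter_upwards [eventually_ne_atTop 0] with n hn
  exact (hτ.integral_ergAvg hg hn).symm

/-- The a.e. limit satisfies $\|f_\infty\|\le\sup_n\|E(f|F_n)\|$, so the differences
$E(f|F_n)-f_\infty$ inherit an integrable supremum and the two-index lemma applies to them. -/
theorem ae_tendsto_ergAvg_condExp [IsFiniteMeasure μ] (hτ : MeasurePreserving τ μ μ)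
    (hle : ∀ n, F n ≤ mΩ) (hlim : MonotoneSigmaLimit F Finf) (f : Ω → X)
    (hsup : ∫⁻ ω, ⨆ n, ‖(μ[f | F n]) ω‖ₑ ∂μ ≠ ⊤) :
    ∀ᵐ ω ∂μ, Tendsto (fun q : ℕ × ℕ => ergAvg τ q.1 (μ[f | F q.2]) ω)
      (atTop ×ˢ atTop) (𝓝 (ergLimit τ (μ[f | Finf]) ω)) := by
  have hconv := ae_tendsto_condExp (μ := μ) hle hlim f
  have hmeas : AEMeasurable (fun ω => ⨆ n, ‖(μ[f | F n]) ω‖ₑ) μ :=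
    .iSup fun n => integrable_condExp.aestronglyMeasurable.enorm
  have hsup' : ∫⁻ ω, ⨆ n, ‖(μ[f | F n] - μ[f | Finf]) ω‖ₑ ∂μ ≠ ⊤ := by
    refine ne_top_of_le_ne_top (ENNReal.add_ne_top.2 ⟨hsup, hsup⟩)
      ((lintegral_mono_ae ?_).trans_eq (lintegral_add_left' hmeas _))
    filter_upwards [hconv] with ω hω
    refine iSup_le fun n => ?_
    have h1 : ‖(μ[f | Finf]) ω‖ₑ ≤ ⨆ n, ‖(μ[f | F n]) ω‖ₑ :=
      le_of_tendsto' hω.enorm fun n => le_iSup (fun n => ‖(μ[f | F n]) ω‖ₑ) n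
    exact enorm_sub_le.trans (add_le_add (le_iSup (fun n => ‖(μ[f | F n]) ω‖ₑ) n) h1)
  have hdiff := hτ.ae_tendsto_birkhoffAverage_prod
    (h := fun n => μ[f | F n] - μ[f | Finf]) (fun n => aestronglyMeasurable_condExp_sub) (by
      filter_upwards [hconv] with ω hω
      simpa using hω.sub_const ((μ[f | Finf]) ω)) hsup'
  obtain ⟨-, hL, -⟩ := hτ.hasErgLimit le_rfl ENNReal.one_ne_top
    (memLp_one_iff_integrable.2 (integrable_condExp (m := Finf) (μ := μ) (f := f)))
  filter_upwards [hdiff, hL] with ω h1 h2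
  have h3 := h1.add (h2.comp (tendsto_fst (g := (atTop : Filter ℕ))))
  rw [zero_add] at h3
  refine h3.congr fun q => ?_
  simp [ergAvg_eq_birkhoffAverage, birkhoffAverage_sub]

end

end MeasureTheory

theorem theorem3p3 {Ω X : Type*} {mΩ : MeasurableSpace Ω}
    [NormedAddCommGroup X] [NormedSpace ℝ X] [CompleteSpace X] (hX : IsReflexiveSpace X)
    (μ : Measure Ω) [IsFiniteMeasure μ]
    (τ : Ω → Ω) (hτ : MeasurePreserving τ μ μ)
    (F : ℕ → MeasurableSpace Ω) (Finf : MeasurableSpace Ω) (hF : ∀ n, F n ≤ mΩ)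
    (hlim : MonotoneSigmaLimit F Finf)
    (p : ENNReal) (hp : 1 ≤ p) (hp' : p ≠ ⊤) (f : Ω → X) (hf : MemLp f p μ) :
    -- the limits `f^*` and `f_∞^* = (E(f|F_∞))^*` exist, a.e. and in `L_p`
    HasErgLimit μ p τ f ∧ HasErgLimit μ p τ (μ[f | Finf]) ∧
    -- norm convergence, independently in the two indices, and the norm bounds
    Tendsto (fun q : ℕ × ℕ =>
        eLpNorm (fun ω => ergAvg τ q.1 (μ[f | F q.2]) ω - ergLimit τ (μ[f | Finf]) ω) p μ)
      (atTop ×ˢ atTop) (𝓝 0) ∧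
    eLpNorm (ergLimit τ (μ[f | Finf])) p μ ≤ eLpNorm f p μ ∧
    eLpNorm (μ[ergLimit τ f | Finf]) p μ ≤ eLpNorm f p μ ∧
    -- under an integrable supremum: convergence a.e. and in `L_1`, and preservation of the expectation
    (∫⁻ ω, ⨆ n, ‖(μ[f | F n]) ω‖ₑ ∂μ < ⊤ →
      (∀ᵐ ω ∂μ, Tendsto (fun q : ℕ × ℕ => ergAvg τ q.1 (μ[f | F q.2]) ω)
        (atTop ×ˢ atTop) (𝓝 (ergLimit τ (μ[f | Finf]) ω))) ∧
      Tendsto (fun q : ℕ × ℕ =>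
          eLpNorm (fun ω => ergAvg τ q.1 (μ[f | F q.2]) ω - ergLimit τ (μ[f | Finf]) ω) 1 μ)
        (atTop ×ˢ atTop) (𝓝 0) ∧
      ∫ ω, ergLimit τ (μ[f | Finf]) ω ∂μ = ∫ ω, f ω ∂μ ∧
      ∫ ω, (μ[ergLimit τ f | Finf]) ω ∂μ = ∫ ω, f ω ∂μ) := by
  have hfi : Integrable f μ := hf.integrable hp
  have hf1 : MemLp f 1 μ := memLp_one_iff_integrable.2 hfi
  have hE := hτ.hasErgLimit hp hp' hf
  have hEinf := hτ.hasErgLimit hp hp' (hf.condExp (m := Finf) hp)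
  refine ⟨hE, hEinf, tendsto_eLpNorm_ergAvg_condExp hτ hF hlim hp hp' hf,
    (hτ.eLpNorm_ergLimit_le hp integrable_condExp.aestronglyMeasurable hEinf.2.1).trans
      (eLpNorm_condExp_le_eLpNorm f hp),
    (eLpNorm_condExp_le_eLpNorm _ hp).trans (hτ.eLpNorm_ergLimit_le hp hf.1 hE.2.1),
    fun hsup => ⟨ae_tendsto_ergAvg_condExp hτ hF hlim f hsup.ne,
      tendsto_eLpNorm_ergAvg_condExp hτ hF hlim le_rfl ENNReal.one_ne_top hf1, ?_, ?_⟩⟩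
  · rw [hτ.integral_ergLimit integrable_condExp, integral_condExp (hlim.le hF)]
  · rw [integral_condExp (hlim.le hF), hτ.integral_ergLimit hfi]
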